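/- **Definitions.** Let $X$ be a metric space and let $\mathcal X,\mathcal Y$ be families of subsets of $X$. A family is *$R$-disjoint* if any two distinct members $U\ne U'$ satisfy $d(U,U')=\inf\{d(u,u') : u\in U,\ u'\in U'\}>R$, and *uniformly bounded* if the diameters of its members are bounded by one number. For $R>0$ write $\mathcal X\xrightarrow{R}\mathcal Y$ if every $Z\in\mathcal X$ is a union $Z=Y^0\cup Y^1$ in which each $Y^i$ is the union of an $R$-disjoint family of members of $\mathcal Y$. * $X$ has *straight finite decomposition complexity* (sFDC) if for every sequence $0<R_1\le R_2\le\cdots$ there are $n$ and families $\mathcal Y^1,\dots,\mathcal Y^n$ with $\{X\}\xrightarrow{R_1}\mathcal Y^1\xrightarrow{R_2}\cdots\xrightarrow{R_n}\mathcal Y^n$ and $\mathcal Y^n$ uniformly bounded. * $X$ has *finite decomposition complexity* (FDC) if Player 2 has a winning strategy in the following game: starting from $\mathcal Y^0=\{X\}$, in round $i$ Player 1 chooses $R_i>0$ and Player 2 answers with a family $\mathcal Y^i$ such that $\mathcal Y^{i-1}\xrightarrow{R_i}\mathcal Y^i$; Player 2 wins if some $\mathcal Y^n$ is uniformly bounded.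 A countable group has sFDC (respectively FDC) if it has this property in a proper (all balls finite) left-invariant metric; such metrics exist, and the property does not depend on the choice. For a simple graph $\Gamma$ with vertex set $V$ and groups $(G_v)_{v\in V}$, the *graph product* $\Gamma\mathfrak G$ is the quotient of the free product of the $G_v$ by the relations $gh=hg$ for all $g\in G_v$, $h\in G_w$ with $v,w$ adjacent. **Corollary 5.5.** 1. If $1\to K\to G\to H\to 1$ is an exact sequence of groups and $K$ and $H$ are countable with sFDC, then $G$ is countable and has sFDC. 2. (a) If $A$ and $B$ are countable groups with sFDC and $C\hookrightarrow A$, $C\hookrightarrow B$ are injective homomorphisms, then the amalgamated free product $A*_C B$ is countable and has sFDC. (b) If $G$ is a countable group with sFDC, $A,B\le G$ are subgroups and $\varphi:A\to B$ is an isomorphism, then the HNN extension of $G$ with respect to $\varphi$ is countable and has sFDC. 3. If $\Gamma$ is a finite simple graph and every $G_v$ is a countable group with sFDC, then $\Gamma\mathfrak G$ is countable and has sFDC. 4. If $\Gamma$ is a finite simple graph and every $G_v$ is a countable group with FDC, then $\Gamma\mathfrak G$ is countable and has FDC. -/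

import Mathlib

namespace CoarseDecomp

section MetricNotions

variable {X : Type*} [MetricSpace X]

/-- `inf {d(x, y) | x ∈ U, y ∈ V} > R`; the infimum over the empty set is `+∞`, so the condition
holds when one of the sets is empty. -/
def Separated (R : ℝ) (U V : Set X) : Prop :=
  ∃ S : ℝ, R < S ∧ ∀ x ∈ U, ∀ y ∈ V, S ≤ dist x y

/-- A family of subsets is `R`-disjoint if distinct members are at distance greater than `R`. -/
def RDisjoint (R : ℝ) (𝒰 : Set (Set X)) : Prop :=
  ∀ U ∈ 𝒰, ∀ V ∈ 𝒰, U ≠ V → Separated R U V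

/-- A family of subsets is uniformly bounded if one number bounds the diameters of its members. -/
def UniformlyBounded (𝒰 : Set (Set X)) : Prop :=
  ∃ D : ℝ, ∀ U ∈ 𝒰, ∀ x ∈ U, ∀ y ∈ U, dist x y ≤ D

/-- The relation `𝒳 --R--> 𝒴` between metric families: every member of `𝒳` is a union of two sets,
each of which is the union of an `R`-disjoint family of members of `𝒴`.  The families that occur in
iterated decompositions of a space `X` consist of subspaces of `X`, so metric families are
families of subsets of a fixed metric space. -/
def Decomposes (R : ℝ) (𝒳 𝒴 : Set (Set X)) : Prop :=
  ∀ Z ∈ 𝒳, ∃ 𝒜 ℬ : Set (Set X), 𝒜 ⊆ 𝒴 ∧ ℬ ⊆ 𝒴 ∧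
    RDisjoint R 𝒜 ∧ RDisjoint R ℬ ∧ Z = ⋃₀ 𝒜 ∪ ⋃₀ ℬ

variable (X)

/-- Straight finite decomposition complexity of a metric space.  The sequence `R₁ ≤ R₂ ≤ ⋯` is
indexed from `0`, and `𝒴 0` is the family whose only member is the whole space. -/
def HasSFDC : Prop :=
  ∀ R : ℕ → ℝ, (∀ i, 0 < R i) → Monotone R →
    ∃ (n : ℕ) (𝒴 : ℕ → Set (Set X)), 𝒴 0 = {Set.univ} ∧
      (∀ i < n, Decomposes (R i) (𝒴 i) (𝒴 (i + 1))) ∧ UniformlyBounded (𝒴 n)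

/-- A winning strategy for Player 2 in the metric decomposition game of `X`.  `σ [R₁, …, Rₙ]` is
the family chosen by Player 2 after Player 1 has played `R₁, …, Rₙ`; the game starts at the family
whose only member is `X`, every answer is a legal decomposition, and every play reaches a
uniformly bounded family after finitely many steps.  (Demanding legal answers also after a
uniformly bounded family is no restriction, since any family decomposes over itself.) -/
structure IsWinningStrategy (σ : List ℝ → Set (Set X)) : Prop where
  start : σ [] = {Set.univ}
  legal : ∀ l : List ℝ, (∀ r ∈ l, 0 < r) → ∀ R : ℝ, 0 < R → Decomposes R (σ l) (σ (l ++ [R]))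
  wins : ∀ R : ℕ → ℝ, (∀ i, 0 < R i) → ∃ n : ℕ, UniformlyBounded (σ ((List.range n).map R))

/-- Finite decomposition complexity of a metric space: Player 2 has a winning strategy. -/
def HasFDC : Prop :=
  ∃ σ : List ℝ → Set (Set X), IsWinningStrategy X σ

end MetricNotions

section Groups

/-- The metric is left-invariant and proper, i.e. all its balls are finite. -/
structure IsProperLeftInvariant (G : Type*) [Group G] (m : MetricSpace G) : Prop where
  dist_mul_left : ∀ g x y : G, m.dist (g * x) (g * y) = m.dist x y
  finite_ball : ∀ r : ℝ, {x : G | m.dist 1 x ≤ r}.Finite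

/-- Straight finite decomposition complexity of a group: it is countable (as implied by the
existence of a proper left-invariant metric) and has straight finite decomposition complexity in a
proper left-invariant metric.  Every countable group carries such a metric, and the choice of the
metric is immaterial, see `GroupHasSFDC.of_metric`. -/
def GroupHasSFDC (G : Type*) [Group G] : Prop :=
  ∃ m : MetricSpace G, IsProperLeftInvariant G m ∧ @HasSFDC G m

/-- Finite decomposition complexity of a group, see `GroupHasFDC.of_metric` for the independence
of the metric. -/
def GroupHasFDC (G : Type*) [Group G] : Prop :=
  ∃ m : MetricSpace G, IsProperLeftInvariant G m ∧ @HasFDC G m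

theorem exists_control {G : Type*} [Group G] {m m' : MetricSpace G}
    (hm : IsProperLeftInvariant G m) (hm' : IsProperLeftInvariant G m') :
    ∃ ρ : ℝ → ℝ, Monotone ρ ∧ (∀ r, 0 < ρ r) ∧
      ∀ (r : ℝ) (x y : G), m.dist x y ≤ r → m'.dist x y ≤ ρ r := by
  have hb : ∀ r : ℝ, BddAbove ((fun x : G => m'.dist 1 x) '' {x | m.dist 1 x ≤ r}) := fun r =>
    ((hm.finite_ball r).image _).bddAbove
  refine ⟨fun r => sSup (insert 1 ((fun x : G => m'.dist 1 x) '' {x | m.dist 1 x ≤ r})),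
    ?_, ?_, ?_⟩
  · intro r s hrs
    refine csSup_le_csSup ((hb s).insert 1) (Set.insert_nonempty _ _) ?_
    apply Set.insert_subset_insert
    apply Set.image_mono
    intro x hx
    exact le_trans hx hrs
  · intro r
    exact lt_of_lt_of_le one_pos (le_csSup ((hb r).insert 1) (Set.mem_insert _ _))
  · intro r x y hxy
    refine le_csSup ((hb r).insert 1) (Set.mem_insert_of_mem _ ⟨x⁻¹ * y, ?_, ?_⟩)
    · have := hm.dist_mul_left x⁻¹ x y
      rw [inv_mul_cancel] at this
      change m.dist 1 (x⁻¹ * y) ≤ r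
      rw [this]; exact hxy
    · have := hm'.dist_mul_left x⁻¹ x y
      rw [inv_mul_cancel] at this
      exact this

theorem Decomposes.of_control {X : Type*} {m m' : MetricSpace X} {R S : ℝ}
    (h : ∃ R' > R, ∀ x y : X, m.dist x y ≤ R' → m'.dist x y ≤ S)
    {𝒳 𝒴 : Set (Set X)} (hd : @Decomposes X m' S 𝒳 𝒴) : @Decomposes X m R 𝒳 𝒴 := by
  obtain ⟨R', hR', h⟩ := h
  have key : ∀ 𝒰 : Set (Set X), @RDisjoint X m' S 𝒰 → @RDisjoint X m R 𝒰 := by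
    intro 𝒰 h𝒰 U hU V hV hUV
    obtain ⟨T, hT, hs⟩ := h𝒰 U hU V hV hUV
    refine ⟨R', hR', fun x hx y hy => ?_⟩
    by_contra! hlt
    exact absurd (hs x hx y hy) (not_le.2 (lt_of_le_of_lt (h x y hlt.le) hT))
  intro Z hZ
  obtain ⟨𝒜, ℬ, h1, h2, h3, h4, h5⟩ := hd Z hZ
  exact ⟨𝒜, ℬ, h1, h2, key _ h3, key _ h4, h5⟩

theorem UniformlyBounded.of_control {X : Type*} {m m' : MetricSpace X} {ρ : ℝ → ℝ}
    (h : ∀ (r : ℝ) (x y : X), m'.dist x y ≤ r → m.dist x y ≤ ρ r)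
    {𝒰 : Set (Set X)} (hb : @UniformlyBounded X m' 𝒰) : @UniformlyBounded X m 𝒰 := by
  obtain ⟨D, hD⟩ := hb
  exact ⟨ρ D, fun U hU x hx y hy => h D x y (hD U hU x hx y hy)⟩

/-- If a group has sFDC, then it has sFDC in every proper left-invariant metric. -/
theorem GroupHasSFDC.of_metric {G : Type*} [Group G] (hG : GroupHasSFDC G) (m : MetricSpace G)
    (hm : IsProperLeftInvariant G m) : @HasSFDC G m := by
  obtain ⟨m', hm', h⟩ := hG
  obtain ⟨ρ, hρm, hρp, hρ⟩ := exists_control hm hm'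
  obtain ⟨τ, -, -, hτ⟩ := exists_control hm' hm
  intro R hR hmono
  obtain ⟨n, 𝒴, h0, hd, hb⟩ := h (fun i => ρ (R i + 1)) (fun i => hρp _)
    (fun i j hij => hρm (by have := hmono hij; linarith))
  exact ⟨n, 𝒴, h0, fun i hi =>
    Decomposes.of_control (m := m) (m' := m')
      ⟨R i + 1, by linarith, fun x y => hρ (R i + 1) x y⟩ (hd i hi),
    UniformlyBounded.of_control (m := m) (m' := m') hτ hb⟩

/-- If a group has FDC, then it has FDC in every proper left-invariant metric. -/
theorem GroupHasFDC.of_metric {G : Type*} [Group G] (hG : GroupHasFDC G) (m : MetricSpace G)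
    (hm : IsProperLeftInvariant G m) : @HasFDC G m := by
  obtain ⟨m', hm', σ, hσ⟩ := hG
  obtain ⟨ρ, -, hρp, hρ⟩ := exists_control hm hm'
  obtain ⟨τ, -, -, hτ⟩ := exists_control hm' hm
  refine ⟨fun l => σ (l.map fun r => ρ (r + 1)), @IsWinningStrategy.mk G m _ ?_ ?_ ?_⟩
  · exact @IsWinningStrategy.start G m' σ hσ
  · intro l hl R hR
    have := @IsWinningStrategy.legal G m' σ hσ (l.map fun r => ρ (r + 1)) (by
      intro r hr
      obtain ⟨s, -, rfl⟩ := List.mem_map.1 hr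
      exact hρp _) (ρ (R + 1)) (hρp _)
    simp only [List.map_append, List.map_cons, List.map_nil]
    exact Decomposes.of_control (m := m) (m' := m')
      ⟨R + 1, by linarith, fun x y => hρ (R + 1) x y⟩ this
  · intro R hR
    obtain ⟨n, hn⟩ := @IsWinningStrategy.wins G m' σ hσ (fun i => ρ (R i + 1)) (fun i => hρp _)
    refine ⟨n, ?_⟩
    rw [List.map_map]
    exact UniformlyBounded.of_control (m := m) (m' := m') hτ hn

/-- The graph product of the groups `G v` over the simple graph `Γ`: the free product of the `G v`
modulo the relations `g h = h g` for `g ∈ G v`, `h ∈ G w` with `v`, `w` adjacent. -/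
abbrev GraphProduct {V : Type*} (Γ : SimpleGraph V) (G : V → Type*) [∀ v, Group (G v)] : Type _ :=
  Monoid.CoprodI G ⧸ Subgroup.normalClosure
    {x : Monoid.CoprodI G | ∃ v w : V, Γ.Adj v w ∧ ∃ (g : G v) (h : G w),
      x = (Monoid.CoprodI.of g * Monoid.CoprodI.of h) * (Monoid.CoprodI.of h * Monoid.CoprodI.of g)⁻¹}

end Groups

end CoarseDecomp

namespace CoarseDecomp

/-! Both complexities are treated at once as a property `FamilyHas k` of families of subsets, built
from bounded families by decomposition steps. For FDC this is an inductive predicate whose proofs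
are well-founded winning strategies; for sFDC it is a finite chain along each sequence of scales.

Fibering (`FamilyHas.of_fibering`) says that the property lifts along uniformly controlled maps when
it holds for the preimages of bounded sets. It yields subgroups, unions of cosets and extensions. A
group acting on a tree has the complexity of the vertex stabilizers (`familyHas_of_tree`):
horizontal bands of the tree split the group into pieces over subtrees of bounded height, and these
are peeled level by level down to cosets of the stabilizer. Normal forms provide the Bass–Serre tree
of an HNN extension, coded as a tree of lists.

An amalgam of `A` and `B` over `C` embeds in an HNN extension of `A × B` whose stable letter
conjugates one copy of `C` to the other, by `a ↦ (a, 1)` and `b ↦ t (1, b) t⁻¹`; Britton's lemma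
gives injectivity (`eq_one_of_amalgamHNN`). A graph product is built one vertex `v` at a time by
amalgamating the subgroup of the earlier vertices with the product of `G v` and the subgroup of its
earlier neighbours (`GroupHas.vertexSub_insert`). This happens among subgroups of the full graph
product, so no smaller graph product has to be identified. -/

/-- The two kinds of decomposition complexity. -/
inductive Complexity
  | sfdc
  | fdc

/-! ### Decomposition complexity of families: inductive form, transfer, fibering -/

section Families

variable {X : Type*} [MetricSpace X]

/-- The families of subsets from which Player 2 wins the decomposition game. -/
inductive FDCFamily : Set (Set X) → Prop
  | bounded {𝒳 : Set (Set X)} (h : UniformlyBounded 𝒳) : FDCFamily 𝒳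
  | step {𝒳 : Set (Set X)} (f : ℝ → Set (Set X)) (hd : ∀ R, 0 < R → Decomposes R 𝒳 (f R))
      (hf : ∀ R, 0 < R → FDCFamily (f R)) : FDCFamily 𝒳

/-- The families of subsets that can be decomposed to a uniformly bounded family along a finite
initial part of a fixed sequence of scales. -/
inductive ChainDecomposes : (ℕ → ℝ) → Set (Set X) → Prop
  | bounded {R : ℕ → ℝ} {𝒳 : Set (Set X)} (h : UniformlyBounded 𝒳) : ChainDecomposes R 𝒳
  | step {R : ℕ → ℝ} {𝒳 𝒴 : Set (Set X)} (hd : Decomposes (R 0) 𝒳 𝒴)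
      (h : ChainDecomposes (fun i => R (i + 1)) 𝒴) : ChainDecomposes R 𝒳

/-- Straight finite decomposition complexity of a family. -/
def SFDCFamily (𝒳 : Set (Set X)) : Prop :=
  ∀ R : ℕ → ℝ, (∀ i, 0 < R i) → Monotone R → ChainDecomposes R 𝒳

/-- (Straight) finite decomposition complexity of a family of subsets. -/
def FamilyHas : Complexity → Set (Set X) → Prop
  | .sfdc, 𝒳 => SFDCFamily 𝒳
  | .fdc, 𝒳 => FDCFamily 𝒳

theorem chainDecomposes_iff {R : ℕ → ℝ} {𝒳 : Set (Set X)} :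
    ChainDecomposes R 𝒳 ↔ ∃ (n : ℕ) (𝒴 : ℕ → Set (Set X)), 𝒴 0 = 𝒳 ∧
      (∀ i < n, Decomposes (R i) (𝒴 i) (𝒴 (i + 1))) ∧ UniformlyBounded (𝒴 n) := by
  constructor
  · intro h
    induction h with
    | @bounded R 𝒳 h => exact ⟨0, fun _ => 𝒳, rfl, by simp, h⟩
    | @step R 𝒳 𝒵 hd h ih =>
      obtain ⟨n, 𝒴, h0, h1, h2⟩ := ih
      refine ⟨n + 1, fun i => Nat.casesOn i 𝒳 𝒴, rfl, ?_, h2⟩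
      rintro (_ | i) hi
      · simpa [h0] using hd
      · exact h1 i (by omega)
  · rintro ⟨n, 𝒴, rfl, h1, h2⟩
    induction n generalizing R 𝒴 with
    | zero => exact .bounded h2
    | succ n ih =>
      exact .step (h1 0 (by omega)) (ih (fun i => 𝒴 (i + 1)) (fun i hi => h1 (i + 1) (by omega)) h2)

theorem hasSFDC_iff : HasSFDC X ↔ SFDCFamily {(Set.univ : Set X)} :=
  forall₃_congr fun _ _ _ => chainDecomposes_iff.symm

theorem FDCFamily.exists_strategy {𝒳 : Set (Set X)} (h : FDCFamily 𝒳) :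
    ∃ σ : List ℝ → Set (Set X), σ [] = 𝒳 ∧
      (∀ l : List ℝ, (∀ r ∈ l, 0 < r) → ∀ R : ℝ, 0 < R → Decomposes R (σ l) (σ (l ++ [R]))) ∧
      ∀ R : ℕ → ℝ, (∀ i, 0 < R i) → ∃ n : ℕ, UniformlyBounded (σ ((List.range n).map R)) := by
  induction h with
  | @bounded 𝒳 h =>
    -- Once the family is bounded, Player 2 repeats it forever: each member is decomposed as itself
    -- together with an empty union.
    refine ⟨fun _ => 𝒳, rfl, fun _ _ R _ Z hZ => ⟨{Z}, ∅, ?_, ?_, ?_, ?_, ?_⟩, fun R _ => ⟨0, h⟩⟩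
    · simpa using hZ
    · simp
    · rintro U rfl V rfl h
      exact absurd rfl h
    · rintro U ⟨⟩
    · simp
  | @step 𝒳 f hd hf ih =>
    choose! τ h0 h1 h2 using ih
    refine ⟨fun l => match l with
      | [] => 𝒳
      | R :: l => τ R l, rfl, ?_, ?_⟩
    · rintro (_ | ⟨r, l⟩) hl R hR
      · simpa [h0 R hR] using hd R hR
      · exact h1 r (hl r (by simp)) l (fun s hs => hl s (by simp [hs])) R hR
    · intro R hR
      obtain ⟨n, hn⟩ := h2 (R 0) (hR 0) (fun i => R (i + 1)) (fun i => hR _)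
      refine ⟨n + 1, ?_⟩
      rw [List.range_succ_eq_map, List.map_cons, List.map_map]
      exact hn

/-- The game is determined: if the starting family were not in the inductive class, Player 1 could
always choose a scale after which the answer of `σ` is still outside it. The resulting infinite play
never reaches a bounded family, against `wins`. -/
theorem hasFDC_iff : HasFDC X ↔ FDCFamily {(Set.univ : Set X)} := by
  constructor
  · rintro ⟨σ, h0, h1, h2⟩
    by_contra hcon
    have key : ∀ l : List ℝ, (∀ r ∈ l, 0 < r) → ¬ FDCFamily (σ l) →
        ∃ R, 0 < R ∧ ¬ FDCFamily (σ (l ++ [R])) := by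
      intro l hl h
      by_contra! hc
      exact h (.step (fun R => σ (l ++ [R])) (h1 l hl) hc)
    choose! next hpos hnext using key
    let L : ℕ → List ℝ := fun n => Nat.rec [] (fun _ l => l ++ [next l]) n
    have hL : ∀ n, (∀ r ∈ L n, 0 < r) ∧ ¬ FDCFamily (σ (L n)) := by
      intro n
      induction n with
      | zero => exact ⟨by simp [L], by simpa [L, h0] using hcon⟩
      | succ n ih =>
        refine ⟨?_, hnext _ ih.1 ih.2⟩
        intro r hr
        rcases List.mem_append.1 hr with hr | hr
        · exact ih.1 r hr
        · rw [List.mem_singleton.1 hr]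
          exact hpos _ ih.1 ih.2
    have hR : ∀ n, (List.range n).map (fun i => next (L i)) = L n := by
      intro n
      induction n with
      | zero => rfl
      | succ n ih => rw [List.range_succ, List.map_append, ih]; rfl
    obtain ⟨n, hn⟩ := h2 (fun i => next (L i)) (fun i => hpos _ (hL i).1 (hL i).2)
    rw [hR] at hn
    exact (hL n).2 (.bounded hn)
  · intro h
    obtain ⟨σ, h0, h1, h2⟩ := h.exists_strategy
    exact ⟨σ, h0, h1, h2⟩

theorem FamilyHas.of_bounded (k : Complexity) {𝒳 : Set (Set X)} (h : UniformlyBounded 𝒳) :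
    FamilyHas k 𝒳 := by
  cases k
  · exact fun R _ _ => .bounded h
  · exact .bounded h

theorem FamilyHas.of_decomposes {k : Complexity} {𝒳 : Set (Set X)}
    (h : ∀ R, 0 < R → ∃ 𝒴, Decomposes R 𝒳 𝒴 ∧ FamilyHas k 𝒴) : FamilyHas k 𝒳 := by
  cases k
  · intro R hR hm
    obtain ⟨𝒴, h1, h2⟩ := h (R 0) (hR 0)
    exact .step h1 (h2 _ (fun i => hR _) fun i j hij => hm (by omega))
  · choose! f hd hf using h
    exact .step f hd hf

/-- A relation between families that lifts decompositions, up to a change of scale, pulls back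
decomposition complexity. -/
theorem FamilyHas.transfer {Y : Type*} [MetricSpace Y] {k : Complexity} {ρ : ℝ → ℝ}
    (hρm : Monotone ρ) (hρp : ∀ r, 0 < ρ r) (Φ : Set (Set X) → Set (Set Y) → Prop)
    (hstep : ∀ 𝒵 𝒲 𝒲' R, Φ 𝒵 𝒲 → Decomposes (ρ R) 𝒲 𝒲' → ∃ 𝒵', Decomposes R 𝒵 𝒵' ∧ Φ 𝒵' 𝒲')
    (hbdd : ∀ 𝒵 𝒲, Φ 𝒵 𝒲 → UniformlyBounded 𝒲 → FamilyHas k 𝒵)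
    {𝒵 : Set (Set X)} {𝒲 : Set (Set Y)} (h𝒲 : FamilyHas k 𝒲) (hΦ : Φ 𝒵 𝒲) : FamilyHas k 𝒵 := by
  cases k
  · intro R hR hm
    have h := h𝒲 (fun i => ρ (R i)) (fun i => hρp _) (fun i j hij => hρm (hm hij))
    clear h𝒲
    generalize hS : (fun i => ρ (R i)) = S at h
    induction h generalizing R 𝒵 with
    | bounded h => exact hbdd _ _ hΦ h R hR hm
    | step hd h ih =>
      subst hS
      obtain ⟨𝒵', h1, h2⟩ := hstep _ _ _ _ hΦ hd
      exact .step h1 (ih (𝒵 := 𝒵') h2 (fun i => R (i + 1)) (fun i => hR _)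
        (fun i j hij => hm (by omega)) rfl)
  · change FDCFamily 𝒲 at h𝒲
    induction h𝒲 generalizing 𝒵 with
    | bounded h => exact hbdd _ _ hΦ h
    | step f hd hf ih =>
      refine FamilyHas.of_decomposes fun R hR => ?_
      obtain ⟨𝒵', h1, h2⟩ := hstep _ _ _ _ hΦ (hd (ρ R) (hρp R))
      exact ⟨𝒵', h1, ih _ (hρp R) h2⟩

theorem RDisjoint.preimage {Y : Type*} [MetricSpace Y] {R R' S : ℝ} (hR : R < R') {Z : Set X}
    {f : X → Y} (hf : ∀ x ∈ Z, ∀ y ∈ Z, dist x y ≤ R' → dist (f x) (f y) ≤ S)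
    {𝒜 : Set (Set Y)} (h : RDisjoint S 𝒜) : RDisjoint R ((fun A => Z ∩ f ⁻¹' A) '' 𝒜) := by
  rintro _ ⟨A, hA, rfl⟩ _ ⟨B, hB, rfl⟩ hne
  obtain ⟨T, hT, h⟩ := h A hA B hB (fun h => hne (by rw [h]))
  refine ⟨R', hR, fun x hx y hy => ?_⟩
  by_contra! hlt
  exact absurd (h _ hx.2 _ hy.2) (not_le.2 ((hf x hx.1 y hy.1 hlt.le).trans_lt hT))

/-- Fibering: complexity lifts along uniformly controlled partial maps whose families of uniformly
bounded preimages have it. -/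
theorem FamilyHas.of_fibering {Y : Type*} [MetricSpace Y] {k : Complexity} {ρ : ℝ → ℝ}
    (hρm : Monotone ρ) (hρp : ∀ r, 0 < ρ r) (ℱ : Set (Set X × (X → Y)))
    (hℱ : ∀ p ∈ ℱ, ∀ x ∈ p.1, ∀ y ∈ p.1, ∀ r, dist x y ≤ r → dist (p.2 x) (p.2 y) ≤ ρ r)
    (hfib : ∀ (𝒵 : Set (Set X)) (D : ℝ), (∀ Z ∈ 𝒵, ∃ p ∈ ℱ, Z ⊆ p.1 ∧
      ∀ x ∈ Z, ∀ y ∈ Z, dist (p.2 x) (p.2 y) ≤ D) → FamilyHas k 𝒵)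
    {𝒵 : Set (Set X)} {𝒲 : Set (Set Y)} (h𝒲 : FamilyHas k 𝒲)
    (h𝒵 : ∀ Z ∈ 𝒵, ∃ p ∈ ℱ, Z ⊆ p.1 ∧ ∃ W ∈ 𝒲, ∀ x ∈ Z, p.2 x ∈ W) : FamilyHas k 𝒵 := by
  -- Pulling back at scale `R + 1` instead of `R` leaves the slack needed for the strict inequality
  -- in `Separated`.
  refine FamilyHas.transfer (ρ := fun r => ρ (r + 1)) (fun r s hrs => hρm (by linarith))
    (fun r => hρp _)
    (fun 𝒵 𝒲 => ∀ Z ∈ 𝒵, ∃ p ∈ ℱ, Z ⊆ p.1 ∧ ∃ W ∈ 𝒲, ∀ x ∈ Z, p.2 x ∈ W) ?_ ?_ h𝒲 h𝒵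
  · intro 𝒵 𝒲 𝒲' R h hd
    refine ⟨{Z' | ∃ Z ∈ 𝒵, ∃ p ∈ ℱ, Z ⊆ p.1 ∧ ∃ W ∈ 𝒲', Z' = Z ∩ p.2 ⁻¹' W}, ?_, ?_⟩
    · intro Z hZ
      obtain ⟨p, hp, hZp, W, hW, hZW⟩ := h Z hZ
      obtain ⟨𝒜, ℬ, hA, hB, dA, dB, rfl⟩ := hd W hW
      have hc : ∀ x ∈ Z, ∀ y ∈ Z, dist x y ≤ R + 1 → dist (p.2 x) (p.2 y) ≤ ρ (R + 1) :=
        fun x hx y hy hxy => hℱ p hp x (hZp hx) y (hZp hy) _ hxy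
      refine ⟨_, _, ?_, ?_, dA.preimage (lt_add_one R) hc, dB.preimage (lt_add_one R) hc, ?_⟩
      · rintro _ ⟨A, hA', rfl⟩
        exact ⟨Z, hZ, p, hp, hZp, A, hA hA', rfl⟩
      · rintro _ ⟨A, hA', rfl⟩
        exact ⟨Z, hZ, p, hp, hZp, A, hB hA', rfl⟩
      · ext x
        simp only [Set.mem_union, Set.mem_sUnion, Set.mem_image, exists_exists_and_eq_and,
          Set.mem_inter_iff, Set.mem_preimage]
        constructor
        · intro hx
          rcases hZW x hx with ⟨A, hA, hxA⟩ | ⟨A, hA, hxA⟩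
          · exact .inl ⟨A, hA, hx, hxA⟩
          · exact .inr ⟨A, hA, hx, hxA⟩
        · rintro (⟨A, -, hx, -⟩ | ⟨A, -, hx, -⟩) <;> exact hx
    · rintro _ ⟨Z, hZ, p, hp, hZp, W, hW, rfl⟩
      exact ⟨p, hp, fun x hx => hZp hx.1, W, hW, fun x hx => hx.2⟩
  · rintro 𝒵 𝒲 h ⟨D, hD⟩
    refine hfib 𝒵 D fun Z hZ => ?_
    obtain ⟨p, hp, hZp, W, hW, hZW⟩ := h Z hZ
    exact ⟨p, hp, hZp, fun x hx y hy => hD W hW _ (hZW x hx) _ (hZW y hy)⟩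

/-- Fibering along nearby-point maps: they move points by at most `S`, so they are uniformly
controlled and preimages of bounded sets stay bounded. -/
theorem FamilyHas.thicken {k : Complexity} {𝒵 𝒲 : Set (Set X)} (h : FamilyHas k 𝒲) (S : ℝ)
    (h𝒵 : ∀ Z ∈ 𝒵, ∃ W ∈ 𝒲, ∀ x ∈ Z, ∃ w ∈ W, dist x w ≤ S) : FamilyHas k 𝒵 := by
  refine FamilyHas.of_fibering (ρ := fun r => max r 0 + 2 * |S| + 1) ?_ ?_
    {p | ∀ x ∈ p.1, dist x (p.2 x) ≤ S} ?_ ?_ h ?_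
  · intro r s hrs
    have := max_le_max_right 0 hrs
    dsimp only
    linarith
  · intro r
    positivity
  · intro p hp x hx y hy r hr
    have h1 := hp x hx
    have h2 := hp y hy
    have h3 := dist_triangle4 (p.2 x) x y (p.2 y)
    rw [dist_comm (p.2 x) x] at h3
    have := le_abs_self S
    have := le_max_left r 0
    linarith
  · intro 𝒵 D h
    refine FamilyHas.of_bounded k ⟨D + 2 * S, fun Z hZ x hx y hy => ?_⟩
    obtain ⟨p, hp, hZp, hD⟩ := h Z hZ
    have h1 := hp x (hZp hx)
    have h2 := hp y (hZp hy)
    have h3 := dist_triangle4 x (p.2 x) (p.2 y) y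
    rw [dist_comm (p.2 y) y] at h3
    have := hD x hx y hy
    linarith
  · intro Z hZ
    obtain ⟨W, hW, h⟩ := h𝒵 Z hZ
    choose! f hf hd using h
    exact ⟨(Z, f), hd, subset_rfl, W, hW, hf⟩

end Families

/-! ### Groups: proper metrics, subgroups, cosets and extensions -/

section Groups

/-- (Straight) finite decomposition complexity of a group. -/
def GroupHas (k : Complexity) (G : Type*) [Group G] : Prop :=
  ∃ m : MetricSpace G, IsProperLeftInvariant G m ∧ @FamilyHas G m k {Set.univ}

theorem groupHas_sfdc {G : Type*} [Group G] : GroupHas .sfdc G ↔ GroupHasSFDC G :=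
  exists_congr fun m => and_congr_right fun _ => (@hasSFDC_iff G m).symm

theorem groupHas_fdc {G : Type*} [Group G] : GroupHas .fdc G ↔ GroupHasFDC G :=
  exists_congr fun m => and_congr_right fun _ => (@hasFDC_iff G m).symm

/-- Any function is bounded on a finite sublevel set. Applied to balls of a proper metric, this is
the source of the control functions used for groups below. Inserting `1` makes the supremum
positive. -/
theorem exists_bound {α : Type*} (a b : α → ℝ) (h : ∀ r, {x | a x ≤ r}.Finite) :
    ∃ ρ : ℝ → ℝ, Monotone ρ ∧ (∀ r, 0 < ρ r) ∧ ∀ r x, a x ≤ r → b x ≤ ρ r := by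
  have hb : ∀ r, BddAbove (insert 1 (b '' {x | a x ≤ r})) := fun r =>
    ((h r).image _).bddAbove.insert 1
  refine ⟨fun r => sSup (insert 1 (b '' {x | a x ≤ r})), fun r s hrs => ?_, fun r => ?_,
    fun r x hx => le_csSup (hb r) (.inr ⟨x, hx, rfl⟩)⟩
  · refine csSup_le_csSup (hb s) (Set.insert_nonempty _ _) (Set.insert_subset_insert ?_)
    exact Set.image_mono fun x hx => le_trans hx hrs
  · exact one_pos.trans_le (le_csSup (hb r) (Set.mem_insert _ _))

theorem IsProperLeftInvariant.dist_eq {G : Type*} [Group G] [MetricSpace G]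
    (hG : IsProperLeftInvariant G ‹_›) (x y : G) : dist x y = dist 1 (x⁻¹ * y) := by
  have := hG.dist_mul_left x⁻¹ x y
  rw [inv_mul_cancel] at this
  exact this.symm

theorem IsProperLeftInvariant.countable {G : Type*} [Group G] {m : MetricSpace G}
    (hG : IsProperLeftInvariant G m) : Countable G := by
  rw [← Set.countable_univ_iff]
  refine (Set.countable_iUnion fun n : ℕ => (hG.finite_ball n).countable).mono fun x _ => ?_
  obtain ⟨n, hn⟩ := exists_nat_ge (m.dist 1 x)
  exact Set.mem_iUnion.2 ⟨n, hn⟩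

theorem GroupHas.countable {k : Complexity} {G : Type*} [Group G] (h : GroupHas k G) :
    Countable G := by
  obtain ⟨m, hm, -⟩ := h
  exact hm.countable

open Pointwise in
theorem exists_isProperLeftInvariant (G : Type*) [Group G] [Countable G] :
    ∃ m : MetricSpace G, IsProperLeftInvariant G m := by
  classical
  obtain ⟨e, he⟩ := exists_surjective_nat G
  -- Finite symmetric sets that exhaust `G`; the norm of `g` is the first index whose set contains
  -- `g`. Since each set contains the square of the previous one, a product of nontrivial elements
  -- has norm at most the maximum plus one, hence at most the sum.
  let F : ℕ → Set G := fun n => Nat.rec {1} (fun n (S : Set G) => S * S ∪ {e n, (e n)⁻¹}) n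
  have hF : ∀ n, F (n + 1) = F n * F n ∪ {e n, (e n)⁻¹} := fun n => rfl
  have h1 : ∀ n, (1 : G) ∈ F n := by
    intro n
    induction n with
    | zero => rfl
    | succ n ih => exact .inl ⟨1, ih, 1, ih, one_mul 1⟩
  have hmono : Monotone F := monotone_nat_of_le_succ fun n x hx =>
    .inl ⟨x, hx, 1, h1 n, mul_one x⟩
  have hfin : ∀ n, (F n).Finite := by
    intro n
    induction n with
    | zero => exact Set.finite_singleton 1
    | succ n ih => exact (ih.mul ih).union (Set.toFinite _)
  have hinv : ∀ n, ∀ x ∈ F n, x⁻¹ ∈ F n := by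
    intro n
    induction n with
    | zero => rintro x rfl; exact inv_one
    | succ n ih =>
      rintro x (⟨y, hy, z, hz, rfl⟩ | rfl | rfl)
      · exact .inl ⟨z⁻¹, ih z hz, y⁻¹, ih y hy, (mul_inv_rev y z).symm⟩
      · exact .inr (.inr rfl)
      · exact .inr (.inl (inv_inv _))
  have hex : ∀ g, ∃ n, g ∈ F n := by
    intro g
    obtain ⟨n, rfl⟩ := he g
    exact ⟨n + 1, .inr (.inl rfl)⟩
  let len : G → ℕ := fun g => @Nat.find (fun n => g ∈ F n) (Classical.decPred _) (hex g)
  have hlen : ∀ g n, len g ≤ n ↔ g ∈ F n := fun g n =>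
    ⟨fun h => hmono h (@Nat.find_spec _ (Classical.decPred _) (hex g)),
      fun h => @Nat.find_min' _ (Classical.decPred _) _ _ h⟩
  have hzero : ∀ g, len g = 0 ↔ g = 1 := fun g => by
    rw [← Nat.le_zero, hlen]; rfl
  have hmul : ∀ g h, len (g * h) ≤ len g + len h := by
    intro g h
    by_cases hg : g = 1
    · simp [hg]
    by_cases hh : h = 1
    · simp [hh]
    have hg' := Nat.pos_of_ne_zero (mt (hzero g).1 hg)
    have hh' := Nat.pos_of_ne_zero (mt (hzero h).1 hh)
    have : len (g * h) ≤ max (len g) (len h) + 1 :=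
      (hlen _ _).2 (.inl ⟨g, (hlen _ _).1 (le_max_left _ _), h, (hlen _ _).1 (le_max_right _ _),
        rfl⟩)
    omega
  have hinv' : ∀ g, len g⁻¹ ≤ len g := fun g => (hlen _ _).2 (hinv _ _ ((hlen _ _).1 le_rfl))
  refine ⟨{
    dist := fun x y => len (x⁻¹ * y)
    dist_self := ?_
    dist_comm := ?_
    dist_triangle := ?_
    eq_of_dist_eq_zero := ?_ }, ?_, ?_⟩
  · intro x
    simp [(hzero 1).2 rfl]
  · intro x y
    have h1 := hinv' (x⁻¹ * y)
    have h2 := hinv' (y⁻¹ * x)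
    simp only [mul_inv_rev, inv_inv] at h1 h2
    exact congrArg Nat.cast (le_antisymm h2 h1)
  · intro x y z
    have := hmul (x⁻¹ * y) (y⁻¹ * z)
    rw [mul_assoc, mul_inv_cancel_left] at this
    exact_mod_cast this
  · intro x y h
    have := (hzero _).1 (Nat.cast_eq_zero.1 h)
    exact (inv_mul_eq_one.1 this)
  · intro g x y
    change ((len ((g * x)⁻¹ * (g * y)) : ℕ) : ℝ) = len (x⁻¹ * y)
    rw [mul_inv_rev, mul_assoc, inv_mul_cancel_left]
  · intro r
    refine (hfin ⌊r⌋₊).subset fun x hx => (hlen _ _).1 ?_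
    have hx' : ((len (1⁻¹ * x) : ℕ) : ℝ) ≤ r := hx
    rw [inv_one, one_mul] at hx'
    exact Nat.le_floor hx'

section Metric

variable {k : Complexity} {K G : Type*} [Group K] [Group G] [MetricSpace K] [MetricSpace G]

theorem exists_hom_control (hK : IsProperLeftInvariant K ‹_›) (hG : IsProperLeftInvariant G ‹_›)
    (f : K →* G) : ∃ ρ : ℝ → ℝ, Monotone ρ ∧ (∀ r, 0 < ρ r) ∧
      ∀ r x y, dist x y ≤ r → dist (f x) (f y) ≤ ρ r := by
  obtain ⟨ρ, h1, h2, h3⟩ := exists_bound (fun x : K => dist 1 x) (fun x => dist 1 (f x))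
    hK.finite_ball
  refine ⟨ρ, h1, h2, fun r x y h => ?_⟩
  rw [hK.dist_eq] at h
  rw [hG.dist_eq, ← map_inv, ← map_mul]
  exact h3 r _ h

theorem exists_hom_expansion (hK : IsProperLeftInvariant K ‹_›) (hG : IsProperLeftInvariant G ‹_›)
    {f : K →* G} (hf : Function.Injective f) : ∃ ρ : ℝ → ℝ, Monotone ρ ∧ (∀ r, 0 < ρ r) ∧
      ∀ r x y, dist (f x) (f y) ≤ r → dist x y ≤ ρ r := by
  obtain ⟨ρ, h1, h2, h3⟩ := exists_bound (fun x : K => dist 1 (f x)) (fun x => dist 1 x)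
    (fun r => (hG.finite_ball r).preimage hf.injOn)
  refine ⟨ρ, h1, h2, fun r x y h => ?_⟩
  rw [hG.dist_eq, ← map_inv, ← map_mul] at h
  rw [hK.dist_eq]
  exact h3 r _ h

/-- An injective homomorphism is a coarse embedding for proper left-invariant metrics, so preimages
of bounded families are bounded and fibering applies. -/
theorem FamilyHas.comap_hom (hK : IsProperLeftInvariant K ‹_›) (hG : IsProperLeftInvariant G ‹_›)
    {f : K →* G} (hf : Function.Injective f) (h : FamilyHas k {(Set.univ : Set G)}) :
    FamilyHas k {(Set.univ : Set K)} := by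
  obtain ⟨ρ, hm, hp, hρ⟩ := exists_hom_control hK hG f
  obtain ⟨τ, -, -, hτ⟩ := exists_hom_expansion hK hG hf
  refine FamilyHas.of_fibering hm hp {(Set.univ, ⇑f)} ?_ ?_ h ?_
  · rintro _ rfl x - y - r
    exact hρ r x y
  · intro 𝒵 D h
    refine FamilyHas.of_bounded k ⟨τ D, fun Z hZ x hx y hy => hτ _ _ _ ?_⟩
    obtain ⟨_, rfl, -, h⟩ := h Z hZ
    exact h x hx y hy
  · rintro _ -
    exact ⟨_, rfl, Set.subset_univ _, Set.univ, rfl, fun _ _ => trivial⟩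

/-- The translates of the image of an injective homomorphism inherit its complexity. -/
theorem FamilyHas.cosets (hK : IsProperLeftInvariant K ‹_›) (hG : IsProperLeftInvariant G ‹_›)
    {f : K →* G} (hf : Function.Injective f) (h : FamilyHas k {(Set.univ : Set K)})
    {𝒵 : Set (Set G)} (h𝒵 : ∀ Z ∈ 𝒵, ∃ g : G, ∀ x ∈ Z, g⁻¹ * x ∈ f.range) : FamilyHas k 𝒵 := by
  obtain ⟨ρ, hm, hp, hρ⟩ := exists_hom_expansion hK hG hf
  obtain ⟨τ, -, -, hτ⟩ := exists_hom_control hK hG f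
  have hd : ∀ (p : Set G × (G → K)) (g : G), (∀ x ∈ p.1, x = g * f (p.2 x)) →
      ∀ x ∈ p.1, ∀ y ∈ p.1, dist x y = dist (f (p.2 x)) (f (p.2 y)) := by
    intro p g hp x hx y hy
    conv_lhs => rw [hp x hx, hp y hy]
    exact hG.dist_mul_left _ _ _
  refine FamilyHas.of_fibering hm hp {p | ∃ g, ∀ x ∈ p.1, x = g * f (p.2 x)} ?_ ?_ h ?_
  · rintro p ⟨g, hg⟩ x hx y hy r hr
    rw [hd p g hg x hx y hy] at hr
    exact hρ r _ _ hr
  · intro 𝒵 D h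
    refine FamilyHas.of_bounded k ⟨τ D, fun Z hZ x hx y hy => ?_⟩
    obtain ⟨p, ⟨g, hg⟩, hZp, h⟩ := h Z hZ
    rw [hd p g hg x (hZp hx) y (hZp hy)]
    exact hτ _ _ _ (h x hx y hy)
  · intro Z hZ
    obtain ⟨g, hg⟩ := h𝒵 Z hZ
    choose! q hq using hg
    refine ⟨(Z, q), ⟨g, fun x hx => ?_⟩, subset_rfl, Set.univ, rfl, fun _ _ => trivial⟩
    dsimp only
    rw [hq x hx, mul_inv_cancel_left]

end Metric

variable {k : Complexity}

theorem GroupHas.of_injective {K G : Type*} [Group K] [Group G] (hG : GroupHas k G) (f : K →* G)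
    (hf : Function.Injective f) : GroupHas k K := by
  have := hG.countable
  have := hf.countable
  obtain ⟨mG, hmG, h⟩ := hG
  obtain ⟨mK, hmK⟩ := exists_isProperLeftInvariant K
  exact ⟨mK, hmK, h.comap_hom hmK hmG hf⟩

theorem GroupHas.of_subsingleton (G : Type*) [Group G] [Subsingleton G] : GroupHas k G := by
  obtain ⟨m, hm⟩ := exists_isProperLeftInvariant G
  refine ⟨m, hm, FamilyHas.of_bounded k ⟨0, fun U _ x _ y _ => ?_⟩⟩
  rw [Subsingleton.elim x y, dist_self]

theorem countable_of_range_eq_ker {K G H : Type*} [Group K] [Group G] [Group H] [Countable K]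
    [Countable H] (f : K →* G) (π : G →* H) (h : f.range = π.ker) : Countable G := by
  let s : H → G := Function.invFun π
  have hs : ∀ g, π (s (π g)) = π g := fun g => Function.invFun_eq ⟨g, rfl⟩
  have : ∀ g, ∃ k, f k = (s (π g))⁻¹ * g := by
    intro g
    change (s (π g))⁻¹ * g ∈ f.range
    rw [h, MonoidHom.mem_ker, map_mul, map_inv, hs, inv_mul_cancel]
  choose q hq using this
  refine Function.Injective.countable (f := fun g => (π g, q g)) fun x y hxy => ?_
  obtain ⟨h1, h2⟩ := Prod.mk.inj hxy
  have := hq x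
  rw [h2, hq y, h1] at this
  exact (mul_left_cancel this).symm

/-- Fibering over `π`: the preimage of a bounded set lies within bounded distance of a single coset
of the image of `K`. -/
theorem GroupHas.of_range_eq_ker {K G H : Type*} [Group K] [Group G] [Group H]
    (hK : GroupHas k K) (hH : GroupHas k H) (f : K →* G) (π : G →* H)
    (hf : Function.Injective f) (h : f.range = π.ker) : GroupHas k G := by
  have := hK.countable
  have := hH.countable
  have := countable_of_range_eq_ker f π h
  obtain ⟨mG, hmG⟩ := exists_isProperLeftInvariant G
  obtain ⟨mK, hmK, dK⟩ := hK
  obtain ⟨mH, hmH, dH⟩ := hH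
  refine ⟨mG, hmG, ?_⟩
  obtain ⟨ρ, hm, hp, hρ⟩ := exists_hom_control hmG hmH π
  refine FamilyHas.of_fibering hm hp {(Set.univ, ⇑π)} ?_ ?_ dH ?_
  · rintro _ rfl x - y - r
    exact hρ r x y
  · intro 𝒵 D h𝒵
    let s : H → G := Function.invFun π
    have hs : ∀ g, π (s (π g)) = π g := fun g => Function.invFun_eq ⟨g, rfl⟩
    obtain ⟨τ, -, -, hτ⟩ := exists_bound (fun x : H => dist 1 x) (fun x => dist (s x) 1)
      hmH.finite_ball
    refine FamilyHas.thicken (𝒲 := {Z | ∃ g : G, Z = {x | g⁻¹ * x ∈ f.range}}) ?_ (τ D) ?_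
    · refine dK.cosets hmK hmG hf ?_
      rintro _ ⟨g, rfl⟩
      exact ⟨g, fun x hx => hx⟩
    · intro Z hZ
      obtain ⟨_, rfl, -, hD⟩ := h𝒵 Z hZ
      obtain rfl | ⟨g, hg⟩ := Z.eq_empty_or_nonempty
      · exact ⟨_, ⟨1, rfl⟩, fun x hx => hx.elim⟩
      -- Dividing by the chosen lift of `π (g⁻¹ * x)` moves `x` into the coset of `g`. Only finitely
      -- many lifts occur over the ball of radius `D`, so the displacement is at most `τ D`.
      refine ⟨_, ⟨g, rfl⟩, fun x hx => ⟨x * (s (π (g⁻¹ * x)))⁻¹, ?_, ?_⟩⟩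
      · change g⁻¹ * (x * (s (π (g⁻¹ * x)))⁻¹) ∈ f.range
        rw [h, MonoidHom.mem_ker, ← mul_assoc, map_mul, map_inv, hs, mul_inv_cancel]
      · have h1 := hD g hg x hx
        dsimp only at h1
        rw [hmH.dist_eq, ← map_inv, ← map_mul] at h1
        have h2 := hτ D _ h1
        rw [hmG.dist_eq] at h2
        rw [dist_comm, hmG.dist_eq]
        rw [dist_comm, hmG.dist_eq] at h2
        simpa [mul_assoc, hmG.dist_eq _ (1 : G)] using h2
  · rintro _ -
    exact ⟨_, rfl, Set.subset_univ _, Set.univ, rfl, fun _ _ => trivial⟩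

theorem inl_injective (A B : Type*) [Group A] [Group B] :
    Function.Injective (MonoidHom.inl A B) := fun _ _ h => congrArg Prod.fst h

theorem GroupHas.prod {A B : Type*} [Group A] [Group B] (hA : GroupHas k A) (hB : GroupHas k B) :
    GroupHas k (A × B) :=
  hA.of_range_eq_ker hB (MonoidHom.inl A B) (MonoidHom.snd A B) (inl_injective A B) (by
    ext ⟨a, b⟩
    rw [MonoidHom.mem_ker, MonoidHom.mem_range]
    simp [eq_comm])

end Groups

/-! ### Groups mapped to a tree of lists -/

section Tree

variable {α : Type*}

/-- Lists that are equal or differ by one leading entry; these are the edges of the tree of lists. -/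
def TailAdjacent (l l' : List α) : Prop :=
  l = l' ∨ (∃ a, l = a :: l') ∨ ∃ a, l' = a :: l

theorem TailAdjacent.symm {l l' : List α} (h : TailAdjacent l l') : TailAdjacent l' l := by
  rcases h with rfl | h | h
  · exact .inl rfl
  · exact .inr (.inr h)
  · exact .inr (.inl h)

theorem TailAdjacent.length_le {l l' : List α} (h : TailAdjacent l l') :
    l.length ≤ l'.length + 1 ∧ l'.length ≤ l.length + 1 := by
  rcases h with rfl | ⟨a, rfl⟩ | ⟨a, rfl⟩
  · omega
  · rw [List.length_cons]; omega
  · rw [List.length_cons]; omega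

theorem TailAdjacent.rtake_eq {l l' : List α} (h : TailAdjacent l l') {m : ℕ}
    (hm : m + 1 ≤ l.length) : l.rtake m = l'.rtake m := by
  have key : ∀ (a : α) (l : List α), m ≤ l.length → (a :: l).rtake m = l.rtake m := by
    intro a l h
    rw [List.rtake.eq_1, List.rtake.eq_1, List.length_cons, Nat.succ_sub h, List.drop_succ_cons]
  rcases h with rfl | ⟨a, rfl⟩ | ⟨a, rfl⟩
  · rfl
  · exact key _ _ (by simpa using hm)
  · exact (key _ _ (by omega)).symm

variable {Q : Type*} [Group Q] (M : Q → List α)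

/-- The words along whose letters the map `M` moves by edges of the tree of lists. -/
def IsWalk (l : List Q) : Prop :=
  ∀ s ∈ l, ∀ x, TailAdjacent (M x) (M (x * s))

variable {M}

theorem IsWalk.of_cons {s : Q} {l : List Q} (h : IsWalk M (s :: l)) :
    (∀ x, TailAdjacent (M x) (M (x * s))) ∧ IsWalk M l :=
  ⟨h s (by simp), fun r hr => h r (by simp [hr])⟩

theorem IsWalk.length_le {l : List Q} (h : IsWalk M l) (x : Q) :
    (M x).length ≤ (M (x * l.prod)).length + l.length ∧
      (M (x * l.prod)).length ≤ (M x).length + l.length := by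
  induction l generalizing x with
  | nil => simp
  | cons s l ih =>
    obtain ⟨h1, h2⟩ := (h.of_cons.1 x).length_le
    obtain ⟨h3, h4⟩ := ih h.of_cons.2 (x * s)
    rw [List.prod_cons, ← mul_assoc, List.length_cons]
    omega

/-- Each letter alters at most the head of the list, so a walk that starts deep enough never touches
the last `m` entries. -/
theorem IsWalk.rtake_eq {l : List Q} (h : IsWalk M l) (x : Q) {m : ℕ}
    (hm : m + l.length ≤ (M x).length) : (M x).rtake m = (M (x * l.prod)).rtake m := by
  induction l generalizing x with
  | nil => simp
  | cons s l ih =>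
    rw [List.length_cons] at hm
    have h1 := (h.of_cons.1 x).length_le
    rw [(h.of_cons.1 x).rtake_eq (by omega), List.prod_cons, ← mul_assoc]
    exact ih h.of_cons.2 (x * s) (by omega)

/-- A walk that leaves the subtree above `a :: σ` passes through `σ`. -/
theorem IsWalk.exists_prefix {l : List Q} (h : IsWalk M l) (x : Q) {a : α} {σ : List α}
    (hx : a :: σ <:+ M x) (hl : ¬ a :: σ <:+ M (x * l.prod)) :
    ∃ l', l' <+: l ∧ M (x * l'.prod) = σ := by
  induction l generalizing x with
  | nil => exact absurd hx (by simpa using hl)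
  | cons s l ih =>
    rw [List.prod_cons, ← mul_assoc] at hl
    by_cases hs : a :: σ <:+ M (x * s)
    · obtain ⟨l', h1, h2⟩ := ih h.of_cons.2 (x * s) hs hl
      exact ⟨s :: l', List.cons_prefix_cons.2 ⟨rfl, h1⟩, by rwa [List.prod_cons, ← mul_assoc]⟩
    · refine ⟨[s], List.cons_prefix_cons.2 ⟨rfl, List.nil_prefix⟩, ?_⟩
      rw [List.prod_singleton]
      rcases h.of_cons.1 x with h | ⟨b, h⟩ | ⟨b, h⟩
      · exact absurd (h ▸ hx) hs
      · rw [h, List.suffix_cons_iff] at hx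
        rcases hx with hx | hx
        · exact ((List.cons.inj hx).2).symm
        · exact absurd hx hs
      · exact absurd (h ▸ hx.trans (List.suffix_cons _ _)) hs

variable (M) in
/-- The elements that `M` maps to at most `n` levels above `σ`. -/
def subtree (σ : List α) (n : ℕ) : Set Q :=
  {x | σ <:+ M x ∧ (M x).length ≤ σ.length + n}

variable {k : Complexity} {H : Type*} [Group H] [MetricSpace H] [MetricSpace Q]

/-- Fix a walk for every group element. As balls are finite, the lengths of the walks and the
excursions of their prefixes are bounded over each ball. -/
theorem exists_walk_bound (hQ : IsProperLeftInvariant Q ‹_›)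
    (hgen : ∀ q, ∃ l, IsWalk M l ∧ l.prod = q) (R : ℝ) :
    ∃ (N : ℕ) (S : ℝ), 0 ≤ S ∧ ∀ x y : Q, dist x y ≤ R → ∃ l, IsWalk M l ∧ y = x * l.prod ∧
      l.length < N ∧ ∀ l', l' <+: l → dist x (x * l'.prod) ≤ S := by
  choose w hw hp using hgen
  obtain ⟨ρ, -, -, hρ⟩ := exists_bound (fun x : Q => dist 1 x) (fun x => ((w x).length : ℝ))
    hQ.finite_ball
  -- The sum over all prefixes serves as a bound for each one, its terms being nonnegative.
  obtain ⟨τ, -, hτ0, hτ⟩ := exists_bound (fun x : Q => dist 1 x)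
    (fun x => ((w x).inits.map fun l => dist 1 l.prod).sum) hQ.finite_ball
  refine ⟨⌊ρ R⌋₊ + 1, τ R, (hτ0 R).le, fun x y hxy => ⟨w (x⁻¹ * y), hw _, ?_, ?_, ?_⟩⟩
  · rw [hp, mul_inv_cancel_left]
  · rw [hQ.dist_eq] at hxy
    exact Nat.lt_succ_of_le (Nat.le_floor (hρ R _ hxy))
  · intro l' hl'
    rw [hQ.dist_eq] at hxy
    rw [hQ.dist_eq, inv_mul_cancel_left]
    refine le_trans (List.single_le_sum ?_ _ ?_) (hτ R _ hxy)
    · simp only [List.mem_map]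
      rintro _ ⟨_, -, rfl⟩
      exact dist_nonneg
    · exact List.mem_map.2 ⟨l', (List.mem_inits _ _).2 hl', rfl⟩

/-- Induction on the height. Height zero is a fibre of `M`, hence lies in one coset. To remove the
top level, separate the points close to the lower subtree from the rest. The rest is grouped by
vertex, and distinct groups are far apart because a walk between them must first descend to the
parent vertex. -/
theorem familyHas_subtree (hH : IsProperLeftInvariant H ‹_›) (hQ : IsProperLeftInvariant Q ‹_›)
    (hgen : ∀ q, ∃ l, IsWalk M l ∧ l.prod = q) {f : H →* Q} (hf : Function.Injective f)
    (hstab : ∀ x y, M x = M y → x⁻¹ * y ∈ f.range)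
    (h : FamilyHas k {(Set.univ : Set H)}) (n : ℕ) :
    FamilyHas k {Z | ∃ σ, Z = subtree M σ n} := by
  induction n with
  | zero =>
    refine h.cosets hH hQ hf ?_
    rintro _ ⟨σ, rfl⟩
    obtain he | ⟨g, hg⟩ := (subtree M σ 0).eq_empty_or_nonempty
    · exact ⟨1, fun x hx => (he ▸ hx : x ∈ (∅ : Set Q)).elim⟩
    · have key : ∀ x ∈ subtree M σ 0, σ = M x := fun x hx => hx.1.eq_of_length_le hx.2
      exact ⟨g, fun x hx => hstab _ _ ((key g hg).symm.trans (key x hx))⟩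
  | succ n ih =>
    refine FamilyHas.of_decomposes fun R hR => ?_
    obtain ⟨_, S, hS, hw⟩ := exists_walk_bound hQ hgen (R + 1)
    refine ⟨{Z | ∃ σ, ∀ x ∈ Z, ∃ w ∈ subtree M σ n, dist x w ≤ S}, ?_,
      ih.thicken S fun Z ⟨σ, hσ⟩ => ⟨_, ⟨σ, rfl⟩, hσ⟩⟩
    rintro _ ⟨σ, rfl⟩
    let N : Set Q := {x | x ∈ subtree M σ (n + 1) ∧ ∃ w ∈ subtree M σ n, dist x w ≤ S}
    let B : List α → Set Q := fun τ =>
      {x | x ∈ subtree M σ (n + 1) ∧ M x = τ ∧ (M x).length = σ.length + n + 1 ∧ x ∉ N}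
    refine ⟨{N}, Set.range B, ?_, ?_, ?_, ?_, ?_⟩
    · rintro _ rfl
      exact ⟨σ, fun x hx => hx.2⟩
    · rintro _ ⟨τ, rfl⟩
      refine ⟨τ, fun x hx => ⟨x, ⟨?_, ?_⟩, by simpa using hS⟩⟩
      · rw [hx.2.1]
      · rw [hx.2.1]; omega
    · rintro _ rfl _ rfl h
      exact absurd rfl h
    · rintro _ ⟨τ, rfl⟩ _ ⟨τ', rfl⟩ hne
      refine ⟨R + 1, lt_add_one R, fun x hx y hy => ?_⟩
      by_contra! hlt
      obtain ⟨l, hl, rfl, -, hlS⟩ := hw x y hlt.le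
      obtain ⟨hx1, hx2, hx3, hx4⟩ := hx
      obtain ⟨hy1, hy2, hy3, hy4⟩ := hy
      obtain ⟨a, ν, hν⟩ : ∃ a ν, M x = a :: ν := by
        refine List.exists_cons_of_length_eq_add_one hx3
      obtain ⟨l', hl', hM⟩ := hl.exists_prefix x (a := a) (σ := ν) (by rw [hν]) (by
        rw [← hν]
        intro hsuf
        have := hsuf.eq_of_length_le (by omega)
        exact hne (by rw [← hx2, ← hy2, this]))
      -- The walk meets the parent `ν` within distance `S` of `x`, and `ν` lies in the lower
      -- subtree, so `x` would belong to `N`.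
      refine hx4 ⟨hx1, x * l'.prod, ⟨?_, ?_⟩, hlS l' hl'⟩
      · have := hx1.1
        rw [hν, List.suffix_cons_iff] at this
        rcases this with h | h
        · rw [hν, h] at hx3
          omega
        · rwa [hM]
      · rw [hν, List.length_cons] at hx3
        rw [hM]
        omega
    · ext x
      simp only [Set.sUnion_singleton, Set.sUnion_range, Set.mem_union, Set.mem_iUnion]
      constructor
      · intro hx
        by_cases hN : x ∈ N
        · exact .inl hN
        · refine .inr ⟨M x, hx, rfl, ?_, hN⟩
          by_contra hlen
          refine hN ⟨hx, x, ⟨hx.1, ?_⟩, by simpa using hS⟩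
          have := hx.2
          omega
      · rintro (hx | ⟨τ, hx⟩) <;> exact hx.1

/-- A group that acts on a tree, here in the form of a map `M` to the tree of lists, has the
complexity of the stabilizers. -/
theorem familyHas_of_tree (hH : IsProperLeftInvariant H ‹_›) (hQ : IsProperLeftInvariant Q ‹_›)
    (hgen : ∀ q, ∃ l, IsWalk M l ∧ l.prod = q) {f : H →* Q} (hf : Function.Injective f)
    (hstab : ∀ x y, M x = M y → x⁻¹ * y ∈ f.range)
    (h : FamilyHas k {(Set.univ : Set H)}) : FamilyHas k {(Set.univ : Set Q)} := by
  refine FamilyHas.of_decomposes fun R hR => ?_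
  obtain ⟨N, S, -, hw⟩ := exists_walk_bound hQ hgen (R + 1)
  obtain hN | hN := Nat.eq_zero_or_pos N
  · obtain ⟨l, -, -, h, -⟩ := hw 1 1 (by rw [dist_self]; linarith)
    omega
  refine ⟨{Z | ∃ σ, Z ⊆ subtree M σ (2 * N)}, ?_,
    (familyHas_subtree hH hQ hgen hf hstab h (2 * N)).thicken 0
      fun Z ⟨σ, hσ⟩ => ⟨_, ⟨σ, rfl⟩, fun x hx => ⟨x, hσ hx, by simp⟩⟩⟩
  -- Points of the band of depths `[q N, (q + 1) N)` are grouped by their ancestor at depth `(q - 1)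
  -- N`. As close points are joined by walks of length less than `N`, they cannot lie in different
  -- bands of the same parity, nor have different ancestors. For `q = 0` truncated subtraction gives
  -- the root.
  let P : ℕ → List α → Set Q := fun q σ =>
    {x | (q * N ≤ (M x).length ∧ (M x).length < (q + 1) * N) ∧ (M x).rtake ((q - 1) * N) = σ}
  have hP : ∀ q σ, P q σ ⊆ subtree M σ (2 * N) := by
    rintro q _ x ⟨⟨h1, h2⟩, rfl⟩
    refine ⟨List.drop_suffix _ _, ?_⟩
    have : (q - 1) * N ≤ q * N := Nat.mul_le_mul_right _ (by omega)
    have h3 : (q + 1) * N ≤ (q - 1 + 2) * N := Nat.mul_le_mul_right _ (by omega)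
    rw [add_mul (q - 1)] at h3
    rw [List.rtake.eq_1, List.length_drop]
    omega
  have hdisj : ∀ i, RDisjoint R {Z | ∃ q σ, Z = P (2 * q + i) σ} := by
    rintro i _ ⟨p, σ, rfl⟩ _ ⟨q, τ, rfl⟩ hne
    refine ⟨R + 1, lt_add_one R, fun x hx y hy => ?_⟩
    by_contra! hlt
    obtain ⟨l, hl, rfl, hlN, -⟩ := hw x y hlt.le
    obtain ⟨⟨hx1, hx2⟩, rfl⟩ := hx
    obtain ⟨⟨hy1, hy2⟩, rfl⟩ := hy
    obtain ⟨h1, h2⟩ := hl.length_le x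
    have far : ∀ p q : ℕ, p < q → (2 * p + i + 1) * N + N ≤ (2 * q + i) * N := by
      intro p q hpq
      rw [← Nat.succ_mul]
      exact Nat.mul_le_mul_right _ (by omega)
    obtain rfl : p = q := by
      rcases lt_trichotomy p q with hpq | hpq | hpq
      · have := far p q hpq
        omega
      · exact hpq
      · have := far q p hpq
        omega
    apply hne
    generalize 2 * p + i = n at *
    cases n with
    | zero => simp [List.rtake.eq_1]
    | succ n =>
      rw [hl.rtake_eq x]
      rw [add_mul] at hx1
      simp only [Nat.add_sub_cancel]
      omega
  rintro _ rfl
  refine ⟨_, _, ?_, ?_, hdisj 0, hdisj 1, ?_⟩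
  · rintro _ ⟨q, σ, rfl⟩
    exact ⟨σ, hP _ _⟩
  · rintro _ ⟨q, σ, rfl⟩
    exact ⟨σ, hP _ _⟩
  · refine (Set.eq_univ_of_forall fun x => ?_).symm
    have h1 : (M x).length / N * N ≤ (M x).length := Nat.div_mul_le_self _ _
    have h2 : (M x).length < ((M x).length / N + 1) * N := by
      rw [mul_comm]; exact Nat.lt_mul_div_succ _ hN
    rcases Nat.even_or_odd' ((M x).length / N) with ⟨q, hq | hq⟩
    · rw [hq] at h1 h2
      exact .inl ⟨_, ⟨q, _, rfl⟩, ⟨h1, h2⟩, rfl⟩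
    · rw [hq] at h1 h2
      exact .inr ⟨_, ⟨q, _, rfl⟩, ⟨h1, h2⟩, rfl⟩

end Tree

theorem IsWalk.append {α Q : Type*} [Group Q] {M : Q → List α} {l l' : List Q} (h : IsWalk M l)
    (h' : IsWalk M l') : IsWalk M (l ++ l') := fun s hs =>
  (List.mem_append.1 hs).elim (h s) (h' s)

theorem IsWalk.inv_reverse {α Q : Type*} [Group Q] {M : Q → List α} {l : List Q}
    (h : IsWalk M l) : IsWalk M (l.map fun x => x⁻¹).reverse := by
  intro s hs x
  obtain ⟨r, hr, rfl⟩ := List.mem_map.1 (List.mem_reverse.1 hs)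
  simpa using (h r hr (x * r⁻¹)).symm

/-! ### HNN extensions and their Bass–Serre tree -/

section HNN

open HNNExtension

variable {k : Complexity} {G : Type*} [Group G] {A B : Subgroup G}

/-- Multiplying a normal form by a stable letter either cancels its first stable letter or puts a
new one in front. -/
theorem tailAdjacent_unitsSMul (φ : A ≃* B) {d : NormalWord.TransversalPair G A B} (u : ℤˣ)
    (w : NormalWord d) : TailAdjacent (NormalWord.unitsSMul φ u w).toList w.toList := by
  rw [NormalWord.unitsSMul]
  split_ifs with h
  · cases w using NormalWord.consRecOn with
    | ofGroup g => simp [NormalWord.Cancels, NormalWord.ofGroup] at h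
    | cons g v w h1 h2 =>
      rw [NormalWord.unitsSMulWithCancel, NormalWord.consRecOn_cons]
      exact .inr (.inr ⟨_, rfl⟩)
  · exact .inr (.inl ⟨_, rfl⟩)

theorem countable_hnnExtension [Countable G] (φ : A ≃* B) :
    Countable (HNNExtension G A B φ) := by
  obtain ⟨d⟩ := NormalWord.TransversalPair.nonempty G A B
  refine Function.Injective.countable (f := fun x : HNNExtension G A B φ =>
    ((NormalWord.equiv φ d x).head, (NormalWord.equiv φ d x).toList)) fun x y h => ?_
  obtain ⟨h1, h2⟩ := Prod.mk.inj h
  exact (NormalWord.equiv φ d).injective (NormalWord.ext h1 h2)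

/-- The list of a normal form, without its head in `G`, names a vertex of the Bass–Serre tree. The
inverse in `M` turns right multiplication, along which walks move, into the left action on normal
forms; base letters then fix the vertex. -/
theorem GroupHas.hnnExtension (hG : GroupHas k G) (φ : A ≃* B) :
    GroupHas k (HNNExtension G A B φ) := by
  have := hG.countable
  have := countable_hnnExtension φ
  obtain ⟨mQ, hmQ⟩ := exists_isProperLeftInvariant (HNNExtension G A B φ)
  obtain ⟨mG, hmG, h⟩ := hG
  refine ⟨mQ, hmQ, ?_⟩
  obtain ⟨d⟩ := NormalWord.TransversalPair.nonempty G A B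
  let M : HNNExtension G A B φ → List (ℤˣ × G) := fun x =>
    (x⁻¹ • (NormalWord.empty : NormalWord d)).toList
  refine familyHas_of_tree (M := M) hmG hmQ ?_ (HNNExtension.of_injective φ) ?_ h
  · intro q
    induction q using HNNExtension.induction_on with
    | of g =>
      refine ⟨[of g], fun s hs x => .inl ?_, List.prod_singleton⟩
      rw [List.mem_singleton.1 hs]
      dsimp only [M]
      rw [mul_inv_rev, mul_smul, ← map_inv, NormalWord.of_smul_eq_smul,
        NormalWord.group_smul_toList]
    | t =>
      refine ⟨[t], fun s hs x => TailAdjacent.symm ?_, List.prod_singleton⟩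
      rw [List.mem_singleton.1 hs]
      dsimp only [M]
      have := NormalWord.t_pow_smul_eq_unitsSMul φ (-1) (x⁻¹ • (NormalWord.empty : NormalWord d))
      rw [Units.val_neg, Units.val_one, zpow_neg_one] at this
      rw [mul_inv_rev, mul_smul, this]
      exact tailAdjacent_unitsSMul φ _ _
    | mul x y hx hy =>
      obtain ⟨l, hl, rfl⟩ := hx
      obtain ⟨l', hl', rfl⟩ := hy
      exact ⟨l ++ l', hl.append hl', List.prod_append⟩
    | inv x hx =>
      obtain ⟨l, hl, rfl⟩ := hx
      exact ⟨_, hl.inv_reverse, (List.prod_inv_reverse l).symm⟩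
  · intro x y hxy
    have key : ∀ z : HNNExtension G A B φ, ∃ g : G,
        z⁻¹ = of g * ((M z).map (fun x => t ^ (x.1 : ℤ) * of x.2)).prod := by
      intro z
      refine ⟨(z⁻¹ • (NormalWord.empty : NormalWord d)).head, ?_⟩
      have := NormalWord.prod_smul φ z⁻¹ (NormalWord.empty : NormalWord d)
      rw [NormalWord.prod_empty, mul_one] at this
      exact this.symm
    obtain ⟨g, hg⟩ := key x
    obtain ⟨g', hg'⟩ := key y
    refine ⟨g * g'⁻¹, ?_⟩
    rw [hg, ← inv_inv y, hg', hxy, map_mul, map_inv]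
    group

end HNN

/-! ### Amalgams inside HNN extensions -/

section Amalgam

open HNNExtension

variable {A B C Q : Type*} [Group A] [Group B] [Group C] [Group Q]

/-- The isomorphism `(1, β c) ↦ (α c, 1)` between the two copies of `C` in `A × B`. -/
noncomputable def rangeEquiv {α : C →* A} {β : C →* B} (hα : Function.Injective α)
    (hβ : Function.Injective β) :
    ((MonoidHom.inr A B).comp β).range ≃* ((MonoidHom.inl A B).comp α).range :=
  (MonoidHom.ofInjective (f := (MonoidHom.inr A B).comp β)
    (fun _ _ h => hβ (congrArg Prod.snd h))).symm.trans
    (MonoidHom.ofInjective (f := (MonoidHom.inl A B).comp α)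
      (fun _ _ h => hα (congrArg Prod.fst h)))

/-- An HNN extension of `A × B` in which `A` and a conjugate of `B` generate their amalgam. -/
abbrev AmalgamHNN {α : C →* A} {β : C →* B} (hα : Function.Injective α)
    (hβ : Function.Injective β) : Type _ :=
  HNNExtension (A × B) _ _ (rangeEquiv hα hβ)

variable {α : C →* A} {β : C →* B} (hα : Function.Injective α) (hβ : Function.Injective β)

theorem AmalgamHNN.conj_of (c : C) :
    (t * of ((1 : A), β c) * t⁻¹ : AmalgamHNN hα hβ) = of (α c, (1 : B)) := by
  have h := equiv_eq_conj (φ := rangeEquiv hα hβ) ⟨((1 : A), β c), c, rfl⟩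
  rw [← h]
  congr 1
  have : (⟨((1 : A), β c), c, rfl⟩ : ((MonoidHom.inr A B).comp β).range) =
      MonoidHom.ofInjective (f := (MonoidHom.inr A B).comp β)
        (fun _ _ h => hβ (congrArg Prod.snd h)) c := rfl
  rw [rangeEquiv, MulEquiv.trans_apply, this, MulEquiv.symm_apply_apply]
  rfl

/-- The product `f a * ∏ g bᵢ * f aᵢ`. -/
def alternatingProd (f : A →* Q) (g : B →* Q) (a : A) (l : List (B × A)) : Q :=
  f a * (l.map fun p => g p.1 * f p.2).prod

/-- No letter of an alternating product, except the first and the last one, is in the amalgamated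
subgroup. -/
def IsReducedAlternating (α : C →* A) (β : C →* B) (l : List (B × A)) : Prop :=
  (∀ p ∈ l, p.1 ∉ β.range) ∧ l.IsChain fun p _ => p.2 ∉ α.range

/-- Multiply by one generator on the left at a time: a letter from the amalgamated subgroup is
absorbed by its neighbour on the other side, and two letters of `B` that become adjacent are merged.
-/
theorem exists_isReducedAlternating {f : A →* Q} {g : B →* Q} (hc : ∀ c, f (α c) = g (β c))
    {q : Q} (hq : q ∈ f.range ⊔ g.range) :
    ∃ a l, IsReducedAlternating α β l ∧ alternatingProd f g a l = q := by
  have hf : ∀ (a : A) (q : Q), (∃ a l, IsReducedAlternating α β l ∧ alternatingProd f g a l = q) →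
      ∃ a' l, IsReducedAlternating α β l ∧ alternatingProd f g a' l = f a * q := by
    rintro a _ ⟨a', l, hl, rfl⟩
    exact ⟨a * a', l, hl, by simp [alternatingProd, mul_assoc]⟩
  have hg : ∀ (b : B) (q : Q), (∃ a l, IsReducedAlternating α β l ∧ alternatingProd f g a l = q) →
      ∃ a l, IsReducedAlternating α β l ∧ alternatingProd f g a l = g b * q := by
    rintro b _ ⟨a, l, hl, rfl⟩
    by_cases hb : b ∈ β.range
    · obtain ⟨c, rfl⟩ := hb
      exact ⟨α c * a, l, hl, by simp [alternatingProd, hc, mul_assoc]⟩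
    by_cases ha : a ∈ α.range
    · rcases l with _ | ⟨⟨b', a'⟩, l⟩
      · refine ⟨1, [(b, a)], ⟨by simpa using hb, by simp⟩, by simp [alternatingProd]⟩
      obtain ⟨c, rfl⟩ := ha
      have hl1 : IsReducedAlternating α β l := ⟨fun p hp => hl.1 p (by simp [hp]), hl.2.tail⟩
      by_cases hb' : b * β c * b' ∈ β.range
      · obtain ⟨c', hc'⟩ := hb'
        refine ⟨α c' * a', l, hl1, ?_⟩
        simp [alternatingProd, hc, hc', mul_assoc]
      · refine ⟨1, (b * β c * b', a') :: l, ⟨?_, ?_⟩, by simp [alternatingProd, hc, mul_assoc]⟩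
        · rintro p hp
          rcases List.mem_cons.1 hp with rfl | hp
          · exact hb'
          · exact hl1.1 p hp
        · rcases l with _ | ⟨p, l⟩
          · simp
          · have := hl.2
            rw [List.isChain_cons_cons] at this ⊢
            exact this
    · refine ⟨1, (b, a) :: l, ⟨?_, ?_⟩, by simp [alternatingProd, mul_assoc]⟩
      · rintro p hp
        rcases List.mem_cons.1 hp with rfl | hp
        · exact hb
        · exact hl.1 p hp
      · rcases l with _ | ⟨p, l⟩
        · simp
        · rw [List.isChain_cons_cons]
          exact ⟨ha, hl.2⟩
  rw [Subgroup.sup_eq_closure] at hq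
  induction hq using Subgroup.closure_induction_left with
  | one => exact ⟨1, [], ⟨by simp, by simp⟩, by simp [alternatingProd]⟩
  | mul_left x hx y _ ih =>
    rcases hx with ⟨a, rfl⟩ | ⟨b, rfl⟩
    · exact hf a y ih
    · exact hg b y ih
  | inv_mul_cancel x hx y _ ih =>
    rcases hx with ⟨a, rfl⟩ | ⟨b, rfl⟩
    · rw [← map_inv]; exact hf a⁻¹ y ih
    · rw [← map_inv]; exact hg b⁻¹ y ih

/-- Writing each `b` as `t (1, b) t⁻¹` gives a word without pinches: `t (1, b) t⁻¹` would need `b`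
in the image of `C`, and `t⁻¹ (a, 1) t` would need `a` there. -/
theorem IsReducedAlternating.isChain {l : List (B × A)} (hl : IsReducedAlternating α β l) :
    (l.flatMap fun p => [((1 : ℤˣ), ((1 : A), p.1)), (-1, (p.2, (1 : B)))]).IsChain fun x y =>
      x.2 ∈ toSubgroup ((MonoidHom.inr A B).comp β).range
        ((MonoidHom.inl A B).comp α).range x.1 → x.1 = y.1 := by
  induction l with
  | nil => simp
  | cons p l ih =>
    have h1 := ih ⟨fun p hp => hl.1 p (by simp [hp]), hl.2.tail⟩
    rw [List.flatMap_cons, List.cons_append, List.cons_append, List.nil_append,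
      List.isChain_cons_cons]
    refine ⟨?_, ?_⟩
    · rintro ⟨c, hc⟩
      exact absurd ⟨c, congrArg Prod.snd hc⟩ (hl.1 p (by simp))
    · rcases l with _ | ⟨q, l⟩
      · simp
      · rw [List.flatMap_cons, List.cons_append, List.isChain_cons_cons]
        refine ⟨?_, h1⟩
        rintro ⟨c, hc⟩
        exact absurd ⟨c, congrArg Prod.fst hc⟩ (List.isChain_cons_cons.1 hl.2).1

/-- A homomorphism to the HNN extension that has the expected values on `A` and `B` is injective on
the subgroup generated by `A` and `B`. -/
theorem eq_one_of_amalgamHNN {f : A →* Q} {g : B →* Q} (hc : ∀ c, f (α c) = g (β c))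
    (F : Q →* AmalgamHNN hα hβ) (hFf : ∀ a, F (f a) = of (a, (1 : B)))
    (hFg : ∀ b, F (g b) = t * of ((1 : A), b) * t⁻¹) {q : Q} (hq : q ∈ f.range ⊔ g.range)
    (h : F q = 1) : q = 1 := by
  obtain ⟨a, l, hl, rfl⟩ := exists_isReducedAlternating hc hq
  have key : ∀ l : List (B × A),
      ((l.flatMap fun p => [((1 : ℤˣ), ((1 : A), p.1)), (-1, (p.2, (1 : B)))]).map
        fun x => (t ^ (x.1 : ℤ) * of x.2 : AmalgamHNN hα hβ)).prod =
      F (l.map fun p => g p.1 * f p.2).prod := by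
    intro l
    induction l with
    | nil => simp
    | cons p l ih =>
      rw [List.flatMap_cons, List.map_append, List.prod_append, List.map_cons (l := l),
        List.prod_cons, map_mul, map_mul, hFf, hFg, ih]
      simp [mul_assoc]
  let w : NormalWord.ReducedWord (A × B) ((MonoidHom.inr A B).comp β).range
      ((MonoidHom.inl A B).comp α).range := ⟨(a, 1), _, hl.isChain⟩
  have hw : w.prod (rangeEquiv hα hβ) = F (alternatingProd f g a l) := by
    rw [alternatingProd, map_mul, hFf, ← key l]
    rfl
  -- Britton's lemma: a reduced word representing an element of the base group has no stable letter,
  -- so `l` is empty.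
  have hnil := ReducedWord.toList_eq_nil_of_mem_of_range (rangeEquiv hα hβ) w
    (by rw [hw, h]; exact one_mem _)
  cases l with
  | nil =>
    have : alternatingProd f g a [] = f a := by simp [alternatingProd]
    rw [this, hFf] at h
    rw [this]
    have := of_injective (rangeEquiv hα hβ) (h.trans (map_one _).symm)
    rw [(Prod.mk.inj this).1, map_one]
  | cons p l => simp [w] at hnil

variable {k : Complexity}

/-- `Q` need not be presented as an amalgam: the mere existence of `F` makes `S` embed in the HNN
extension. -/
theorem GroupHas.of_amalgam (hA : GroupHas k A) (hB : GroupHas k B) {f : A →* Q} {g : B →* Q}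
    (hc : ∀ c, f (α c) = g (β c)) (F : Q →* AmalgamHNN hα hβ)
    (hFf : ∀ a, F (f a) = of (a, (1 : B))) (hFg : ∀ b, F (g b) = t * of ((1 : A), b) * t⁻¹)
    {S : Subgroup Q} (hS : S ≤ f.range ⊔ g.range) : GroupHas k S := by
  refine ((hA.prod hB).hnnExtension (rangeEquiv hα hβ)).of_injective (F.comp S.subtype) ?_
  rw [injective_iff_map_eq_one]
  exact fun x hx => Subtype.ext (eq_one_of_amalgamHNN hα hβ hc F hFf hFg (hS x.2) hx)

theorem GroupHas.of_top (h : GroupHas k (⊤ : Subgroup Q)) : GroupHas k Q :=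
  h.of_injective (Subgroup.topEquiv (G := Q)).symm.toMonoidHom
    (Subgroup.topEquiv (G := Q)).symm.injective

theorem GroupHas.pushoutI {G : Fin 2 → Type*} [∀ i, Group (G i)] {φ : ∀ i, C →* G i}
    (hφ : ∀ i, Function.Injective (φ i)) (hG : ∀ i, GroupHas k (G i)) :
    GroupHas k (Monoid.PushoutI φ) := by
  let f : ∀ i, G i →* AmalgamHNN (hφ 0) (hφ 1) := fun i => match i with
    | 0 => of.comp (MonoidHom.inl _ _)
    | 1 => (MulAut.conj t).toMonoidHom.comp (of.comp (MonoidHom.inr _ _))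
  have hf : ∀ i, (f i).comp (φ i) = (f 0).comp (φ 0) := by
    intro i
    match i with
    | 0 => rfl
    | 1 => exact MonoidHom.ext fun c => AmalgamHNN.conj_of (hφ 0) (hφ 1) c
  refine GroupHas.of_top ((hG 0).of_amalgam (hφ 0) (hφ 1) (hG 1) (f := Monoid.PushoutI.of 0)
    (g := Monoid.PushoutI.of 1) ?_ (Monoid.PushoutI.lift f _ hf) ?_ ?_ ?_)
  · intro c
    rw [Monoid.PushoutI.of_apply_eq_base, Monoid.PushoutI.of_apply_eq_base]
  · intro a
    rw [Monoid.PushoutI.lift_of]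
    rfl
  · intro b
    rw [Monoid.PushoutI.lift_of]
    rfl
  · rintro x -
    have h0 : ∀ i (g : G i), Monoid.PushoutI.of i g ∈
        (Monoid.PushoutI.of (φ := φ) 0).range ⊔ (Monoid.PushoutI.of (φ := φ) 1).range := by
      intro i g
      match i with
      | 0 => exact (le_sup_left : _ ≤ _ ⊔ (Monoid.PushoutI.of (φ := φ) 1).range) ⟨g, rfl⟩
      | 1 => exact (le_sup_right : _ ≤ (Monoid.PushoutI.of (φ := φ) 0).range ⊔ _) ⟨g, rfl⟩
    induction x using Monoid.PushoutI.induction_on with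
    | of i g => exact h0 i g
    | base c =>
      rw [← Monoid.PushoutI.of_apply_eq_base φ 0]
      exact h0 0 _
    | mul x y hx hy => exact mul_mem hx hy

end Amalgam

/-! ### Adding one vertex to a subgroup generated by vertex groups -/

section Vertex

variable {V : Type*} {G : V → Type*} [∀ v, Group (G v)]

section Sub

variable {Q : Type*} [Group Q]

/-- The subgroup generated by the images of the groups of a set of vertices. -/
def vertexSub (ι : ∀ v, G v →* Q) (s : Finset V) : Subgroup Q :=
  ⨆ v ∈ s, (ι v).range

variable {ι : ∀ v, G v →* Q}

theorem mem_vertexSub {s : Finset V} {v : V} (hv : v ∈ s) (g : G v) : ι v g ∈ vertexSub ι s :=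
  (le_iSup₂_of_le v hv le_rfl : (ι v).range ≤ vertexSub ι s) ⟨g, rfl⟩

theorem vertexSub_le {s : Finset V} {S : Subgroup Q} (h : ∀ v ∈ s, ∀ g : G v, ι v g ∈ S) :
    vertexSub ι s ≤ S := by
  refine iSup₂_le fun v hv => ?_
  rintro _ ⟨g, rfl⟩
  exact h v hv g

end Sub

/-- The vertices outside `insert v s` go to `1`, so that the maps can extend to all of the ambient
group. -/
theorem exists_vertexHom {E : Type*} [Group E] {s : Finset V} {v : V} (hv : v ∉ s)
    (a : ∀ w ∈ s, G w →* E) (b : G v →* E) :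
    ∃ f : ∀ w, G w →* E, (∀ w hw, f w = a w hw) ∧ f v = b ∧ ∀ w, w ∉ s → w ≠ v → f w = 1 := by
  classical
  refine ⟨fun w => if hw : w ∈ s then a w hw else if h : w = v then h ▸ b else 1, ?_, ?_, ?_⟩
  · intro w hw
    exact dif_pos hw
  · simp [hv]
  · intro w hw hwv
    simp [hw, hwv]

variable {Q : Type*} [Group Q] {ι : ∀ v, G v →* Q} {Γ : SimpleGraph V}

/-- The inductive step for graph products: the subgroup that belongs to `insert v s` is the amalgam
of the one that belongs to `s` and the product of the group of `v` with the subgroup that belongs to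
the neighbours of `v` in `s`. -/
theorem GroupHas.vertexSub_insert {k : Complexity} [DecidableEq V] {s : Finset V} {v : V}
    (hv : v ∉ s) (hcomm : ∀ v w, Γ.Adj v w → ∀ g g', Commute (ι v g) (ι w g'))
    {L : Subgroup Q} (hL : L ≤ vertexSub ι s)
    (hLmem : ∀ w ∈ s, Γ.Adj w v → ∀ g : G w, ι w g ∈ L)
    (hLR : ∀ (l : L) (g : G v), Commute (l : Q) (ι v g))
    (hlift : ∀ (f : ∀ w, G w →* AmalgamHNN (Subgroup.inclusion_injective hL)
        (β := MonoidHom.inl L (G v)) (inl_injective L (G v))),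
      (∀ w w', Γ.Adj w w' → ∀ g g', Commute (f w g) (f w' g')) → ∃ F : Q →* _, ∀ w g,
        F (ι w g) = f w g)
    (hs : GroupHas k (vertexSub ι s)) (hG : GroupHas k (G v)) :
    GroupHas k (vertexSub ι (insert v s)) := by
  obtain ⟨f, f_mem, f_self, f_ne⟩ := exists_vertexHom
    (E := AmalgamHNN (Subgroup.inclusion_injective hL)
      (β := MonoidHom.inl L (G v)) (inl_injective L (G v))) (G := G) hv
    (fun w hw => HNNExtension.of.comp ((MonoidHom.inl _ _).comp
      ((ι w).codRestrict (vertexSub ι s) (mem_vertexSub hw))))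
    ((MulAut.conj HNNExtension.t).toMonoidHom.comp (HNNExtension.of.comp
      ((MonoidHom.inr _ _).comp (MonoidHom.inr _ _))))
  replace f_mem : ∀ w (hw : w ∈ s) (g : G w),
      f w g = HNNExtension.of (⟨ι w g, mem_vertexSub hw g⟩, 1) :=
    fun w hw g => by rw [f_mem w hw]; rfl
  replace f_self : ∀ g : G v, f v g = HNNExtension.t * HNNExtension.of (1, (1, g)) *
      HNNExtension.t⁻¹ := fun g => by rw [f_self]; rfl
  have comm_self : ∀ w ∈ s, Γ.Adj w v → ∀ (g : G w) (g' : G v), Commute (f w g) (f v g') := by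
    intro w hw h g g'
    have hc := AmalgamHNN.conj_of (Subgroup.inclusion_injective hL) (β := MonoidHom.inl L (G v))
      (inl_injective L (G v)) (⟨ι w g, hLmem w hw h g⟩ : L)
    rw [f_mem w hw, f_self]
    -- The image of `ι w g` is also the conjugate by `t` of its copy in `L × G v`, where it commutes
    -- with `G v`.
    refine Eq.subst (motive := fun x => Commute x _) hc ?_
    refine (Commute.conj_iff _).2 ?_
    have (l : L) : Commute ((1 : vertexSub ι s), (l, (1 : G v))) (1, ((1 : L), g')) := by
      simp [commute_iff_eq]
    exact (this _).map HNNExtension.of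
  have comm : ∀ w w', Γ.Adj w w' → ∀ g g', Commute (f w g) (f w' g') := by
    intro w w' h g g'
    by_cases hw : w ∈ s
    · by_cases hw' : w' ∈ s
      · rw [f_mem w hw, f_mem w' hw']
        have : Commute ((⟨ι w g, mem_vertexSub hw g⟩ : vertexSub ι s), (1 : L × G v))
            (⟨ι w' g', mem_vertexSub hw' g'⟩, 1) :=
          Prod.ext (Subtype.ext (hcomm w w' h g g')) rfl
        exact this.map HNNExtension.of
      · by_cases hv' : w' = v
        · subst hv'
          exact comm_self w hw h g g'
        · rw [f_ne w' hw' hv']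
          exact Commute.one_right _
    · by_cases hwv : w = v
      · subst hwv
        by_cases hw' : w' ∈ s
        · exact (comm_self w' hw' h.symm g' g).symm
        · rw [f_ne w' hw' h.ne']
          exact Commute.one_right _
      · rw [f_ne w hw hwv]
        exact Commute.one_left _
  obtain ⟨F, hF⟩ := hlift f comm
  -- Both sides are homomorphisms on `vertexSub ι s` that agree on generators; the equalizer is
  -- pushed into `Q` so that `vertexSub_le` applies.
  have hFs : ∀ a : vertexSub ι s, F a = HNNExtension.of (a, 1) := by
    have : vertexSub ι s ≤ ((F.comp (vertexSub ι s).subtype).eqLocus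
        (HNNExtension.of.comp (MonoidHom.inl _ _))).map (vertexSub ι s).subtype :=
      vertexSub_le fun w hw g => ⟨⟨ι w g, mem_vertexSub hw g⟩,
        (hF w g).trans (f_mem w hw g), rfl⟩
    rintro ⟨a, ha⟩
    obtain ⟨b, hb, rfl⟩ := this ha
    exact hb
  have hLs : GroupHas k L := hs.of_injective _ (Subgroup.inclusion_injective hL)
  let N : L × G v →* Q := MonoidHom.noncommCoprod L.subtype (ι v) hLR
  have hN : ∀ l g, N (l, g) = l * ι v g := fun _ _ => rfl
  refine hs.of_amalgam (Subgroup.inclusion_injective hL) (β := MonoidHom.inl L (G v))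
    (inl_injective L (G v)) (hLs.prod hG) (f := (vertexSub ι s).subtype)
    (g := N) ?_ F hFs ?_ ?_
  · intro c
    rw [MonoidHom.inl_apply, hN, map_one, mul_one]
    rfl
  · rintro ⟨l, g⟩
    have h1 := (hFs (Subgroup.inclusion hL l)).trans
      (AmalgamHNN.conj_of (Subgroup.inclusion_injective hL) (β := MonoidHom.inl L (G v))
        (inl_injective L (G v)) l).symm
    have h2 := (hF v g).trans (f_self g)
    rw [Subgroup.coe_inclusion] at h1
    rw [hN, map_mul, h1, h2, conj_mul, ← map_mul]
    simp
  · refine vertexSub_le fun w hw g => ?_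
    rcases Finset.mem_insert.1 hw with rfl | hw
    · refine (le_sup_right : _ ≤ (vertexSub ι s).subtype.range ⊔ _) ⟨(1, g), ?_⟩
      rw [hN, Subgroup.coe_one, one_mul]
    · exact (le_sup_left : (vertexSub ι s).subtype.range ≤ _) ⟨⟨_, mem_vertexSub hw g⟩, rfl⟩

end Vertex

/-! ### Graph products and their universal property -/

namespace GraphProduct

variable {V : Type*} {Γ : SimpleGraph V} {G : V → Type*} [∀ v, Group (G v)]

variable (Γ) in
/-- The canonical homomorphism from a vertex group to the graph product. -/
def of (v : V) : G v →* GraphProduct Γ G :=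
  (QuotientGroup.mk' _).comp Monoid.CoprodI.of

theorem of_commute {v w : V} (h : Γ.Adj v w) (g : G v) (g' : G w) :
    Commute (of Γ v g) (of Γ w g') := by
  have h := (QuotientGroup.eq_one_iff _).2 (Subgroup.subset_normalClosure
    (show _ ∈ {x : Monoid.CoprodI G | ∃ v w : V, Γ.Adj v w ∧ ∃ (g : G v) (h : G w),
      x = (Monoid.CoprodI.of g * Monoid.CoprodI.of h) *
        (Monoid.CoprodI.of h * Monoid.CoprodI.of g)⁻¹} from ⟨v, w, h, g, g', rfl⟩))
  exact mul_inv_eq_one.1 h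

/-- The homomorphism from the graph product given by commuting homomorphisms on the vertex
groups. -/
def lift {E : Type*} [Group E] (f : ∀ v, G v →* E)
    (hf : ∀ v w, Γ.Adj v w → ∀ g g', Commute (f v g) (f w g')) : GraphProduct Γ G →* E :=
  QuotientGroup.lift _ (Monoid.CoprodI.lift f) (by
    refine Subgroup.normalClosure_le_normal ?_
    rintro _ ⟨v, w, h, g, g', rfl⟩
    change Monoid.CoprodI.lift f _ = 1
    simp only [map_mul, map_inv, Monoid.CoprodI.lift_of]
    exact mul_inv_eq_one.2 (hf v w h g g'))

theorem lift_of {E : Type*} [Group E] (f : ∀ v, G v →* E)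
    (hf : ∀ v w, Γ.Adj v w → ∀ g g', Commute (f v g) (f w g')) (v : V) (g : G v) :
    lift f hf (of Γ v g) = f v g :=
  Monoid.CoprodI.lift_of f g

theorem vertexSub_univ [Fintype V] : vertexSub (of Γ : ∀ v, G v →* GraphProduct Γ G) Finset.univ = ⊤ := by
  refine eq_top_iff.2 fun x hx => ?_
  clear hx
  obtain ⟨x, rfl⟩ := QuotientGroup.mk_surjective x
  induction x using Monoid.CoprodI.induction_on with
  | one => exact one_mem _
  | of v g => exact mem_vertexSub (Finset.mem_univ v) g
  | mul x y hx hy => exact mul_mem hx hy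

end GraphProduct

theorem GroupHas.graphProduct {k : Complexity} {V : Type*} [Finite V] (Γ : SimpleGraph V)
    {G : V → Type*} [∀ v, Group (G v)] (hG : ∀ v, GroupHas k (G v)) :
    GroupHas k (GraphProduct Γ G) := by
  classical
  have := Fintype.ofFinite V
  refine GroupHas.of_top ?_
  rw [← GraphProduct.vertexSub_univ]
  generalize (Finset.univ : Finset V) = s
  induction s using Finset.induction_on with
  | empty =>
    have : vertexSub (GraphProduct.of Γ : ∀ v, G v →* GraphProduct Γ G) ∅ = ⊥ := by
      simp [vertexSub]
    rw [this]
    exact GroupHas.of_subsingleton _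
  | insert v s hv ih =>
    refine GroupHas.vertexSub_insert hv
      (L := vertexSub (GraphProduct.of Γ) (s.filter fun w => Γ.Adj w v))
      (fun v w h => GraphProduct.of_commute h)
      (vertexSub_le fun w hw g => mem_vertexSub (Finset.mem_filter.1 hw).1 g)
      (fun w hw h g => mem_vertexSub (Finset.mem_filter.2 ⟨hw, h⟩) g) ?_
      (fun f hf => ⟨GraphProduct.lift f hf, GraphProduct.lift_of f hf⟩) ih (hG v)
    -- The generators of `L` come from neighbours of `v`, so `L` lies in the centralizer of each
    -- element from `G v`.
    rintro ⟨l, hl⟩ g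
    refine Subgroup.mem_centralizer_singleton_iff.1 (vertexSub_le (fun w hw g' => ?_) hl)
    exact Subgroup.mem_centralizer_singleton_iff.2
      (GraphProduct.of_commute (Finset.mem_filter.1 hw).2 g' g)

end CoarseDecomp

theorem corollary5p5 :
    -- group extensions `1 → K → G → H → 1`
    (∀ (K G H : Type*) [Group K] [Group G] [Group H], GroupExtension K G H →
      CoarseDecomp.GroupHasSFDC K → CoarseDecomp.GroupHasSFDC H →
        CoarseDecomp.GroupHasSFDC G) ∧
    -- free products of two groups with amalgamation over a common subgroup
    (∀ (C : Type*) (A : Fin 2 → Type*) [Group C] [∀ i, Group (A i)] (φ : ∀ i, C →* A i),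
      (∀ i, Function.Injective (φ i)) →
      (∀ i, CoarseDecomp.GroupHasSFDC (A i)) →
        CoarseDecomp.GroupHasSFDC (Monoid.PushoutI φ)) ∧
    -- HNN extensions
    (∀ (G : Type*) [Group G] (A B : Subgroup G) (φ : A ≃* B),
      CoarseDecomp.GroupHasSFDC G → CoarseDecomp.GroupHasSFDC (HNNExtension G A B φ)) ∧
    -- finite graph products, for sFDC
    (∀ (V : Type*) [Finite V] (Γ : SimpleGraph V) (G : V → Type*) [∀ v, Group (G v)],
      (∀ v, CoarseDecomp.GroupHasSFDC (G v)) →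
        CoarseDecomp.GroupHasSFDC (CoarseDecomp.GraphProduct Γ G)) ∧
    -- finite graph products, for FDC
    (∀ (V : Type*) [Finite V] (Γ : SimpleGraph V) (G : V → Type*) [∀ v, Group (G v)],
      (∀ v, CoarseDecomp.GroupHasFDC (G v)) →
        CoarseDecomp.GroupHasFDC (CoarseDecomp.GraphProduct Γ G)) := by
  simp only [← CoarseDecomp.groupHas_sfdc, ← CoarseDecomp.groupHas_fdc]
  refine ⟨?_, ?_, ?_, ?_, ?_⟩
  · intro K G H _ _ _ S hK hH
    exact hK.of_range_eq_ker hH S.inl S.rightHom S.inl_injective S.range_inl_eq_ker_rightHom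
  · intro C A _ _ φ hφ hA
    exact CoarseDecomp.GroupHas.pushoutI hφ hA
  · intro G _ A B φ hG
    exact hG.hnnExtension φ
  · intro V _ Γ G _ hG
    exact CoarseDecomp.GroupHas.graphProduct Γ hG
  · intro V _ Γ G _ hG
    exact CoarseDecomp.GroupHas.graphProduct Γ hG
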